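/- Let $n\ge 1$. Let $$\Xi_n=\{k\in\{0,1,\dots,n\}^3:\ k_1,k_2,k_3 \text{ all even or all odd}\},\qquad z_k=\bigl(\cos\tfrac{k_1\pi}{n},\cos\tfrac{k_2\pi}{n},\cos\tfrac{k_3\pi}{n}\bigr),\qquad \Gamma_n=\{z_k:k\in\Xi_n\}\subset[-1,1]^3 ,$$ and let $\lambda_k=8,4,2,1$ according to whether $z_k$ lies in the interior of the cube $[-1,1]^3$, on a face but on no edge, on an edge but at no vertex, or at a vertex. Let $$\Lambda_n=\{\nu\in\mathbb Z^3:\ |\nu_a\pm\nu_b|\le n \text{ for } 1\le a<b\le 3\}$$ be the set of integer points of a closed rhombic dodecahedron. For $\nu\in\Lambda_n$ put $\mu_\nu=1$ if $\nu$ is an interior point of the dodecahedron, $\mu_\nu=\frac12$ if it lies on a face but on no edge, $\mu_\nu=\frac13$ if it lies on an edge but is not a vertex, $\mu_\nu=\frac14$ if it is a vertex where three faces meet, and $\mu_\nu=\frac16$ if it is a vertex where four faces meet. Define $$\Phi_n^*(x)=\frac1{2n^3}\sum_{\nu\in\Lambda_n}\mu_\nu e^{2\pi i\,\nu\cdot x},\qquad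 \ell_k(x)=\frac{\lambda_k}{8}\sum_{\varepsilon\in\{-1,1\}^3}\Phi_n^*\bigl(\varepsilon_1x_1-\tfrac{k_1}{2n},\,\varepsilon_2x_2-\tfrac{k_2}{2n},\,\varepsilon_3x_3-\tfrac{k_3}{2n}\bigr)$$ for $x\in\mathbb R^3$ and $k\in\Xi_n$, and let $\ell_k^*$ be the function on $[-1,1]^3$ with $\ell_k^*(\cos2\pi x_1,\cos2\pi x_2,\cos2\pi x_3)=\ell_k(x)$ for $x\in[-\frac12,\frac12]^3$ (it is well defined, since $\ell_k$ is even in each variable). Let $\mathcal L_n$ be the algebraic interpolation operator based on the nodes $\Gamma_n$, $$\mathcal L_nf=\sum_{k\in\Xi_n}f(z_k)\,\ell_k^* ,\qquad f\in C([-1,1]^3),$$ and let $\|\mathcal L_n\|_\infty$ (the Lebesgue constant) denote its operator norm on the space $C([-1,1]^3)$ of continuous complex-valued functions with the maximum norm. Then there is a constant $c$, independent of $n$, such that $$\|\mathcal L_n\|_\infty\le c\,(\log n)^3\qquad\text{for all } n\ge2 .$$ -/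

import Mathlib

/-! Lagrange interpolation on the cube `[-1,1]^3` at a set of about `n^3 / 4` points. -/

noncomputable section

namespace CubeInterp

/-- The cube `[-1,1]^3`. -/
abbrev Cube : Type := Set.Icc (-1 : Fin 3 → ℝ) 1

/-- The exponential `e_ν(x) = exp(2 π i ν · x)`. -/
def expo (ν : Fin 3 → ℤ) (x : Fin 3 → ℝ) : ℂ :=
  Complex.exp (2 * Real.pi * Complex.I * ∑ i, (ν i : ℂ) * (x i : ℂ))

/-- The integer points of the closed rhombic dodecahedron:
`-n ≤ ν_a ± ν_b ≤ n` for `a < b`. (These inequalities imply `|ν_i| ≤ n`.) -/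
def dodecahedron (n : ℕ) : Finset (Fin 3 → ℤ) :=
  (Fintype.piFinset fun _ => Finset.Icc (-(n : ℤ)) n).filter fun ν =>
    ∀ a b, a < b → |ν a + ν b| ≤ n ∧ |ν a - ν b| ≤ n

/-- The homogeneous coordinates `(j_1, j_2, j_3, j_4)`, with sum zero, of `ν ∈ ℤ^3`. -/
def hom (ν : Fin 3 → ℤ) : Fin 4 → ℤ :=
  ![2 * (-ν 0 + ν 1 + ν 2), 2 * (ν 0 - ν 1 + ν 2), 2 * (ν 0 + ν 1 - ν 2),
    2 * (-ν 0 - ν 1 - ν 2)]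

/-- The set `I` of the indices `a` such that `j_a - j_b = 4 n` for some `b`. On the closed
dodecahedron, where all differences are at most `4 n`, a point lies on the face
`j_a - j_b = 4 n` exactly for `a ∈ I` and `b ∈ J`; see `lowIdx` for `J`. -/
def highIdx (n : ℕ) (j : Fin 4 → ℤ) : Finset (Fin 4) :=
  Finset.univ.filter fun a => ∃ b, j a - j b = 4 * (n : ℤ)

/-- The set `J` of the indices `b` such that `j_a - j_b = 4 n` for some `a`. -/
def lowIdx (n : ℕ) (j : Fin 4 → ℤ) : Finset (Fin 4) :=
  Finset.univ.filter fun b => ∃ a, j a - j b = 4 * (n : ℤ)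

/-- The weight of `ν` in the closed dodecahedron: `1 / binom (|I| + |J|, |I|)`. For `n ≥ 1` it is
`1` at interior points, `1/2` inside faces (`|I| = |J| = 1`), `1/3` inside edges
(`|I| + |J| = 3`), and `1/4` or `1/6` at vertices (`{|I|, |J|} = {1, 3}` or `|I| = |J| = 2`). -/
def mu (n : ℕ) (ν : Fin 3 → ℤ) : ℂ :=
  1 / (Nat.choose ((highIdx n (hom ν)).card + (lowIdx n (hom ν)).card)
    (highIdx n (hom ν)).card : ℂ)

/-- The kernel `Φ_n^*(x) = (1 / (2 n^3)) ∑_ν μ_ν e_ν(x)`, summed over the dodecahedron. -/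
def Phi (n : ℕ) (x : Fin 3 → ℝ) : ℂ :=
  1 / (2 * (n : ℂ) ^ 3) * ∑ ν ∈ dodecahedron n, mu n ν * expo ν x

/-- The mean `(P g)(x) = (1/8) ∑_{ε ∈ {-1,1}^3} g(ε_1 x_1, ε_2 x_2, ε_3 x_3)`. -/
def evenPart (g : (Fin 3 → ℝ) → ℂ) (x : Fin 3 → ℝ) : ℂ :=
  1 / 8 * ∑ ε : Fin 3 → ℤˣ, g fun i => ((ε i : ℤ) : ℝ) * x i

/-- The index set `Ξ_n`: the `k ∈ {0, …, n}^3` whose entries are all even or all odd. -/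
def Xi (n : ℕ) : Finset (Fin 3 → ℤ) :=
  (Fintype.piFinset fun _ => Finset.Icc (0 : ℤ) n).filter fun k =>
    (∀ i, Even (k i)) ∨ (∀ i, Odd (k i))

/-- The node `z_k = (cos (k_1 π / n), cos (k_2 π / n), cos (k_3 π / n))`. The map `k ↦ z_k` is a
bijection from `Ξ_n` onto the set `Γ_n` of nodes if `n ≥ 1`. -/
def node (n : ℕ) (k : Fin 3 → ℤ) : Cube :=
  ⟨fun i => Real.cos (k i * Real.pi / n),
    fun _ => Real.neg_one_le_cos _, fun _ => Real.cos_le_one _⟩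

/-- The weight `λ_k`, for `k ∈ Ξ_n`: `8`, `4`, `2` or `1` if `z_k` lies in the interior of the cube,
inside a face, inside an edge, or at a vertex, respectively. -/
def lam (n : ℕ) (k : Fin 3 → ℤ) : ℂ :=
  2 ^ (Finset.univ.filter fun i => 0 < k i ∧ k i < (n : ℤ)).card

/-- The trigonometric fundamental function `ℓ_k(x) = λ_k P[Φ_n^*(· - k/(2n))](x)`. -/
def ell (n : ℕ) (k : Fin 3 → ℤ) (x : Fin 3 → ℝ) : ℂ :=
  lam n k * evenPart (fun y => Phi n fun i => y i - (k i : ℝ) / (2 * n)) x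

theorem continuous_ell (n : ℕ) (k : Fin 3 → ℤ) : Continuous (ell n k) := by
  unfold ell evenPart Phi expo
  fun_prop

/-- The function `ℓ_k^*(s) = ℓ_k(x)` on the cube, where `s_i = cos (2 π x_i)`, for the choice
`x_i = arccos (s_i) / (2 π) ∈ [0, 1/2]`; by `ellStar_cos` below every `x ∈ [-1/2, 1/2]^3` gives
the same value. -/
def ellStar (n : ℕ) (k : Fin 3 → ℤ) : C(Cube, ℂ) where
  toFun s := ell n k fun i => Real.arccos ((s : Fin 3 → ℝ) i) / (2 * Real.pi)
  continuous_toFun := by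
    refine (continuous_ell n k).comp (continuous_pi fun i => ?_)
    exact (Real.continuous_arccos.comp
      ((continuous_apply i).comp continuous_subtype_val)).div_const _

theorem evenPart_sign (g : (Fin 3 → ℝ) → ℂ) (σ : Fin 3 → ℤˣ) (x : Fin 3 → ℝ) :
    evenPart g (fun i => ((σ i : ℤ) : ℝ) * x i) = evenPart g x := by
  unfold evenPart
  congr 1
  refine Fintype.sum_equiv (Equiv.mulRight σ) _ _ fun ε => ?_
  congr 1
  funext i
  simp [mul_assoc]

theorem ellStar_cos (n : ℕ) (k : Fin 3 → ℤ) (x : Fin 3 → ℝ) (hx : ∀ i, |x i| ≤ 1 / 2) :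
    ellStar n k ⟨fun i => Real.cos (2 * Real.pi * x i),
      fun _ => Real.neg_one_le_cos _, fun _ => Real.cos_le_one _⟩ = ell n k x := by
  have hπ := Real.pi_pos
  have habs : ∀ i, Real.arccos (Real.cos (2 * Real.pi * x i)) / (2 * Real.pi) = |x i| := by
    intro i
    rw [← Real.cos_abs, abs_mul, abs_of_pos (by positivity : 0 < 2 * Real.pi),
      Real.arccos_cos (by positivity) (by nlinarith [hx i])]
    field_simp
  have hσ : (fun i => |x i|) =
      fun i => (((if 0 ≤ x i then 1 else -1 : ℤˣ) : ℤ) : ℝ) * x i := by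
    funext i
    split_ifs with h
    · simp [abs_of_nonneg h]
    · simp [abs_of_neg (not_le.mp h)]
  change ell n k (fun i => Real.arccos (Real.cos (2 * Real.pi * x i)) / (2 * Real.pi)) = _
  simp only [habs]
  rw [hσ]
  unfold ell
  rw [evenPart_sign _ (fun i => if 0 ≤ x i then 1 else -1) x]

/-- The interpolation operator `L_n f = ∑_{k ∈ Ξ_n} f(z_k) ℓ_k^*`, as a bounded operator on
`C([-1,1]^3)` with the maximum norm. -/
def L (n : ℕ) : C(Cube, ℂ) →L[ℂ] C(Cube, ℂ) :=
  ∑ k ∈ Xi n, (ContinuousMap.evalCLM ℂ (node n k)).smulRight (ellStar n k)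

theorem L_apply (n : ℕ) (f : C(Cube, ℂ)) (s : Cube) :
    L n f s = ∑ k ∈ Xi n, f (node n k) * ellStar n k s := by
  simp [L, ContinuousMap.sum_apply]

end CubeInterp

end

/-! The norm is at most the maximum of `∑ k, ‖ell n k x‖`. Since `λ_k ≤ 8` cancels the factor 1/8 in
the mean over signs, it suffices to bound `∑ k, ‖Phi n (y - k/(2n))‖` by a multiple of `(log n)^3`,
uniformly in `y`.

The exponential sum over the dodecahedron becomes tractable in four coordinates. Write `ν · x = ∑
p_c t_c` with `∑ t_c = 0`; then `p` matters only up to a common shift and can be normalized to have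
maximum 0. The dodecahedron becomes the set of points of `[-n, 0]^4` with maximum 0 and even
coordinate sum. Splitting by the sets `I`, `J` of indices where the value is 0 or `-n` gives boxes
with constant weight. Without the parity condition, the sum over a box is a product of geometric
sums, and since `I` is nonempty at most three factors are nontrivial (`norm_sum_dodecahedron_le`).

Any three homogeneous coordinates determine `k`, so the sum over nodes is dominated by a product of
three one-dimensional sums, each `O(n log n)` (`sum_majorant_le`). The factor `1/n^3` in the kernel
leaves `(log n)^3`. -/

noncomputable section

namespace CubeInterp

/-! ### Geometric sums in one variable and their majorant on a grid -/

/-- A majorant of the geometric sums `∑_{1 ≤ m < n} e^{-2 π i m t}`. -/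
def majorant (n : ℕ) (t : ℝ) : ℝ := 2 * n / (1 + 2 * n * |t - round t|)

theorem one_le_majorant {n : ℕ} (hn : 1 ≤ n) (t : ℝ) : 1 ≤ majorant n t := by
  have h := abs_sub_round t
  have hn' : (1 : ℝ) ≤ n := by exact_mod_cast hn
  unfold majorant
  rw [le_div_iff₀ (by positivity)]
  nlinarith [abs_nonneg (t - round t)]

theorem majorant_nonneg (n : ℕ) (t : ℝ) : 0 ≤ majorant n t := by
  unfold majorant; positivity

theorem majorant_add_int (n : ℕ) (t : ℝ) (j : ℤ) : majorant n (t + j) = majorant n t := by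
  simp [majorant, round_add_intCast]

theorem norm_exp_sub_one_ge (t : ℝ) :
    4 * |t - round t| ≤ ‖Complex.exp (2 * Real.pi * Complex.I * t) - 1‖ := by
  have h := abs_sub_round t
  have hπ := Real.pi_pos
  have e : Complex.exp (2 * Real.pi * Complex.I * t)
      = Complex.exp (Complex.I * ((2 * Real.pi * (t - round t) : ℝ) : ℂ)) := by
    rw [Complex.exp_eq_exp_iff_exists_int]
    refine ⟨round t, ?_⟩
    push_cast
    ring
  rw [e, Complex.norm_exp_I_mul_ofReal_sub_one, Real.norm_eq_abs, abs_mul, abs_two]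
  have h2 : |2 * Real.pi * (t - round t) / 2| = Real.pi * |t - round t| := by
    rw [show 2 * Real.pi * (t - round t) / 2 = Real.pi * (t - round t) by ring, abs_mul,
      abs_of_pos hπ]
  have h3 := Real.mul_abs_le_abs_sin (x := 2 * Real.pi * (t - round t) / 2)
    (by rw [h2]; nlinarith)
  rw [h2] at h3
  have h4 : 2 / Real.pi * (Real.pi * |t - round t|) = 2 * |t - round t| := by
    field_simp
  linarith

theorem norm_exp_two_pi (t : ℝ) : ‖Complex.exp (2 * Real.pi * Complex.I * t)‖ = 1 := by
  rw [show 2 * Real.pi * Complex.I * t = ((2 * Real.pi * t : ℝ) : ℂ) * Complex.I by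
    push_cast; ring]
  exact Complex.norm_exp_ofReal_mul_I _

/-- The character `e^{2 π i m t}`. -/
def chr (m : ℤ) (t : ℝ) : ℂ := Complex.exp (2 * Real.pi * Complex.I * (m * t))

theorem norm_chr (m : ℤ) (t : ℝ) : ‖chr m t‖ = 1 := by
  have := norm_exp_two_pi (m * t)
  push_cast at this
  exact this

/-- Combines the trivial bound `n` with the telescoping bound `2 / (4 |t - round t|)`: together they
give `‖S‖ (1 + 2n |t - round t|) ≤ 2n`. -/
theorem norm_sum_chr_le {n : ℕ} (hn : 1 ≤ n) (t : ℝ) :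
    ‖∑ m ∈ Finset.Ioo (-(n : ℤ)) 0, chr m t‖ ≤ majorant n t := by
  set S := ∑ m ∈ Finset.Ioo (-(n : ℤ)) 0, chr m t with hS
  have hn' : (1 : ℝ) ≤ n := by exact_mod_cast hn
  have h1 : ‖S‖ ≤ n := by
    refine (norm_sum_le _ _).trans ?_
    simp only [norm_chr, Finset.sum_const, Int.card_Ioo, nsmul_eq_mul, mul_one]
    have : (0 - -(n : ℤ) - 1).toNat ≤ n := by omega
    exact_mod_cast this
  have h2 : S * (Complex.exp (2 * Real.pi * Complex.I * t) - 1) = 1 - chr (1 - n) t := by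
    have key : ∀ N : ℕ, (∑ m ∈ Finset.Ioo (-((N + 1 : ℕ) : ℤ)) 0, chr m t) *
        (Complex.exp (2 * Real.pi * Complex.I * t) - 1) = 1 - chr (1 - (N + 1 : ℕ)) t := by
      intro N
      induction N with
      | zero =>
        have hI : Finset.Ioo (-((0 + 1 : ℕ) : ℤ)) 0 = ∅ := by
          ext m
          simp only [Finset.mem_Ioo, Finset.notMem_empty, iff_false]
          omega
        rw [hI]; simp [chr]
      | succ N ih =>
        have hI : Finset.Ioo (-((N + 1 + 1 : ℕ) : ℤ)) 0
            = insert (-((N + 1 : ℕ) : ℤ)) (Finset.Ioo (-((N + 1 : ℕ) : ℤ)) 0) := by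
          ext m
          simp only [Finset.mem_Ioo, Finset.mem_insert]
          omega
        rw [hI, Finset.sum_insert (by simp), add_mul, ih, mul_sub, mul_one]
        have : chr (-((N + 1 : ℕ) : ℤ)) t * Complex.exp (2 * Real.pi * Complex.I * t)
            = chr (1 - (N + 1 : ℕ)) t := by
          unfold chr
          rw [← Complex.exp_add]
          congr 1
          push_cast
          ring
        rw [this]
        have e : (1 - ((N + 1 + 1 : ℕ) : ℤ)) = -((N + 1 : ℕ) : ℤ) := by push_cast; ring
        rw [e]
        ring
    obtain ⟨N, rfl⟩ : ∃ N, n = N + 1 := ⟨n - 1, by omega⟩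
    exact key N
  have h3 : ‖S‖ * (4 * |t - round t|) ≤ 2 := by
    calc ‖S‖ * (4 * |t - round t|)
        ≤ ‖S‖ * ‖Complex.exp (2 * Real.pi * Complex.I * t) - 1‖ := by
          gcongr; exact norm_exp_sub_one_ge t
      _ = ‖1 - chr (1 - n) t‖ := by rw [← norm_mul, h2]
      _ ≤ ‖(1 : ℂ)‖ + ‖chr (1 - n) t‖ := norm_sub_le _ _
      _ = 2 := by rw [norm_chr]; norm_num
  unfold majorant
  rw [le_div_iff₀ (by positivity)]
  nlinarith

theorem sum_inv_one_add_abs_le (M : ℕ) :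
    ∑ v ∈ Finset.Icc (-(M : ℤ)) M, (1 : ℝ) / (1 + |(v : ℝ)|) ≤ 2 * (1 + Real.log (M + 1)) := by
  have h1 : ∑ v ∈ Finset.Icc (-(M : ℤ)) M, (1 : ℝ) / (1 + |(v : ℝ)|)
      ≤ ∑ d ∈ Finset.range (M + 1), 2 * ((1 : ℝ) / (1 + d)) := by
    rw [← Finset.sum_fiberwise_of_maps_to (g := fun v : ℤ => v.natAbs)
      (t := Finset.range (M + 1))
      (fun v hv => by simp only [Finset.mem_Icc, Finset.mem_range] at *; omega)]
    refine Finset.sum_le_sum fun d _ => ?_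
    have : ∀ v ∈ (Finset.Icc (-(M : ℤ)) M).filter (fun v => v.natAbs = d),
        (1 : ℝ) / (1 + |(v : ℝ)|) = 1 / (1 + d) := by
      intro v hv
      rw [← (Finset.mem_filter.1 hv).2, Nat.cast_natAbs, Int.cast_abs]
    rw [Finset.sum_congr rfl this, Finset.sum_const, nsmul_eq_mul]
    gcongr
    have hc : ((Finset.Icc (-(M : ℤ)) M).filter (fun v => v.natAbs = d)).card
        ≤ ({(d : ℤ), -(d : ℤ)} : Finset ℤ).card := by
      refine Finset.card_le_card fun v hv => ?_
      have := (Finset.mem_filter.1 hv).2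
      simp only [Finset.mem_insert, Finset.mem_singleton]
      omega
    exact_mod_cast hc.trans Finset.card_le_two
  refine h1.trans ?_
  rw [← Finset.mul_sum]
  gcongr
  have h := harmonic_le_one_add_log (M + 1)
  simp only [harmonic, Rat.cast_sum, Rat.cast_inv, Rat.cast_natCast] at h
  push_cast at h
  simpa [add_comm] using h

/-- With `j = round t`, the quantity `4n |t - j|` is the distance from `s` to `4n(τ - j)`; replacing
that point by its floor costs at most 1. As `j` varies with `s`, all four possible values are
summed. -/
theorem majorant_le_sum {n : ℕ} (hn : 1 ≤ n) {τ : ℝ} (h0 : 0 ≤ τ) (h1 : τ < 1) {s : ℤ}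
    (hs : s ∈ Finset.Icc (-(3 * n : ℤ)) (3 * n)) :
    majorant n (τ - s / (4 * n)) ≤
      ∑ j ∈ Finset.Icc (-1 : ℤ) 2, 4 * n * (1 / (1 + |((s - ⌊4 * n * (τ - j)⌋ : ℤ) : ℝ)|)) := by
  have hn' : (1 : ℝ) ≤ n := by exact_mod_cast hn
  set t := τ - s / (4 * n) with ht
  rw [Finset.mem_Icc] at hs
  have hs1 : -(3 * n : ℝ) ≤ s := by exact_mod_cast hs.1
  have hs2 : (s : ℝ) ≤ 3 * n := by exact_mod_cast hs.2
  have hq1 : (s : ℝ) / (4 * n) ≤ 3 / 4 := by rw [div_le_iff₀ (by positivity)]; linarith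
  have hq2 : -(3 / 4) ≤ (s : ℝ) / (4 * n) := by rw [le_div_iff₀ (by positivity)]; linarith
  have hr := abs_le.1 (abs_sub_round t)
  have hr1 : (-2 : ℝ) < round t := by linarith
  have hr2 : (round t : ℝ) < 3 := by linarith
  have hmem : round t ∈ Finset.Icc (-1 : ℤ) 2 := by
    rw [Finset.mem_Icc]
    have a1 : (-2 : ℤ) < round t := by exact_mod_cast hr1
    have a2 : round t < 3 := by exact_mod_cast hr2
    omega
  refine le_trans ?_ (Finset.single_le_sum (f := fun j : ℤ =>
    4 * (n : ℝ) * (1 / (1 + |((s - ⌊4 * n * (τ - j)⌋ : ℤ) : ℝ)|)))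
    (fun j _ => by positivity) hmem)
  set w := 4 * n * (τ - round t) with hw
  have hf1 := Int.floor_le w
  have hf2 := Int.lt_floor_add_one w
  have e : 4 * n * |t - round t| = |w - s| := by
    nth_rewrite 1 [← abs_of_pos (by positivity : (0 : ℝ) < 4 * n)]
    rw [← abs_mul]
    congr 1
    rw [hw, ht]
    field_simp
    ring
  have h3 : |((s - ⌊w⌋ : ℤ) : ℝ)| ≤ |w - s| + 1 := by
    push_cast
    rw [abs_le]
    constructor <;> linarith [le_abs_self (w - s), neg_abs_le (w - s)]
  unfold majorant
  rw [mul_one_div, div_le_div_iff₀ (by positivity) (by positivity)]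
  nlinarith [abs_nonneg (t - round t)]

theorem sum_majorant_le {n : ℕ} (hn : 2 ≤ n) (τ : ℝ) :
    ∑ s ∈ Finset.Icc (-(3 * n : ℤ)) (3 * n), majorant n (τ - s / (4 * n))
      ≤ 224 * n * Real.log n := by
  -- The majorant has period 1 in `τ`.
  wlog hτ : 0 ≤ τ ∧ τ < 1 generalizing τ
  · have := this (Int.fract τ) ⟨Int.fract_nonneg _, Int.fract_lt_one _⟩
    refine le_trans (le_of_eq ?_) this
    refine Finset.sum_congr rfl fun s _ => ?_
    rw [← majorant_add_int n _ (-⌊τ⌋)]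
    congr 1
    rw [← Int.self_sub_floor]
    push_cast
    ring
  obtain ⟨h0, h1⟩ := hτ
  have hn2 : (2 : ℝ) ≤ n := by exact_mod_cast hn
  have hlog : 1 / 2 ≤ Real.log n :=
    (by linarith [Real.log_two_gt_d9] : 1 / 2 ≤ Real.log 2).trans
      (Real.log_le_log (by norm_num) hn2)
  have hbd : ∀ j ∈ Finset.Icc (-1 : ℤ) 2, ∑ s ∈ Finset.Icc (-(3 * n : ℤ)) (3 * n),
      (4 * (n : ℝ) * (1 / (1 + |((s - ⌊4 * n * (τ - j)⌋ : ℤ) : ℝ)|))) ≤ 56 * n * Real.log n := by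
    intro j hj
    rw [Finset.mem_Icc] at hj
    have hj1 : (-1 : ℝ) ≤ j := by exact_mod_cast hj.1
    have hj2 : (j : ℝ) ≤ 2 := by exact_mod_cast hj.2
    set F := ⌊4 * n * (τ - j)⌋ with hF
    have hF1 : -(8 * n : ℤ) ≤ F := by
      rw [hF, Int.le_floor]; push_cast; nlinarith
    have hF2 : F < (8 * n : ℤ) := by
      rw [hF, Int.floor_lt]; push_cast; nlinarith
    have hsub : ∑ s ∈ Finset.Icc (-(3 * n : ℤ)) (3 * n), (1 / (1 + |((s - F : ℤ) : ℝ)|))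
        ≤ ∑ v ∈ Finset.Icc (-((11 * n : ℕ) : ℤ)) ((11 * n : ℕ) : ℤ), (1 : ℝ) / (1 + |(v : ℝ)|) := by
      rw [← Finset.sum_image (g := fun s : ℤ => s - F)
        (f := fun v : ℤ => (1 : ℝ) / (1 + |(v : ℝ)|)) (fun a _ b _ h => by simpa using h)]
      refine Finset.sum_le_sum_of_subset_of_nonneg ?_ (fun _ _ _ => by positivity)
      intro v hv
      simp only [Finset.mem_image, Finset.mem_Icc] at hv ⊢
      obtain ⟨s, hs, rfl⟩ := hv
      push_cast
      omega
    -- For `n ≥ 2`, `11n + 1 ≤ n^5`.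
    have hl : Real.log ((11 * n : ℕ) + 1) ≤ 5 * Real.log n := by
      rw [← Real.log_rpow (by linarith)]
      refine Real.log_le_log (by positivity) ?_
      norm_cast
      nlinarith [pow_le_pow_left₀ (by norm_num) hn 4, pow_succ n 4]
    rw [← Finset.mul_sum]
    have := hsub.trans (sum_inv_one_add_abs_le (11 * n))
    calc 4 * (n : ℝ) * _ ≤ 4 * n * (2 * (1 + Real.log ((11 * n : ℕ) + 1))) := by gcongr
      _ ≤ 4 * n * (2 * (2 * Real.log n + 5 * Real.log n)) := by gcongr; linarith
      _ = _ := by ring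
  calc _ ≤ ∑ s ∈ Finset.Icc (-(3 * n : ℤ)) (3 * n), ∑ j ∈ Finset.Icc (-1 : ℤ) 2,
        4 * (n : ℝ) * (1 / (1 + |((s - ⌊4 * n * (τ - j)⌋ : ℤ) : ℝ)|)) :=
        Finset.sum_le_sum fun s hs => majorant_le_sum (by omega) h0 h1 hs
    _ ≤ ∑ j ∈ Finset.Icc (-1 : ℤ) 2, 56 * n * Real.log n := by
        rw [Finset.sum_comm]; exact Finset.sum_le_sum hbd
    _ = 224 * n * Real.log n := by simp; ring

/-! ### The dodecahedron in normalized homogeneous coordinates -/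

/-- The coordinates `t`, with sum zero, dual to the homogeneous coordinates of `ℤ^3`. -/
def dualCoord (x : Fin 3 → ℝ) : Fin 4 → ℝ :=
  ![(-x 0 + x 1 + x 2) / 2, (x 0 - x 1 + x 2) / 2, (x 0 + x 1 - x 2) / 2,
    (-x 0 - x 1 - x 2) / 2]

/-- The integers `(p_1, …, p_4)` with `ν · x = ∑ p_c t_c` and `p_4 = 0`. -/
def pairSum (ν : Fin 3 → ℤ) : Fin 4 → ℤ := ![ν 1 + ν 2, ν 0 + ν 2, ν 0 + ν 1, 0]

/-- The largest entry of `pairSum ν`. -/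
def pairMax (ν : Fin 3 → ℤ) : ℤ :=
  max (max (pairSum ν 0) (pairSum ν 1)) (max (pairSum ν 2) (pairSum ν 3))

/-- The coordinates of `ν` normalized to have maximum zero. -/
def depth (ν : Fin 3 → ℤ) : Fin 4 → ℤ := fun c => pairSum ν c - pairMax ν

theorem le_pairMax (ν : Fin 3 → ℤ) (c : Fin 4) : pairSum ν c ≤ pairMax ν := by
  unfold pairMax; fin_cases c <;> simp

theorem exists_eq_pairMax (ν : Fin 3 → ℤ) : ∃ c, pairSum ν c = pairMax ν := by
  by_contra! h
  have h0 := h 0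
  have h1 := h 1
  have h2 := h 2
  have h3 := h 3
  unfold pairMax at *
  omega

theorem hom_sub_hom (ν : Fin 3 → ℤ) (a b : Fin 4) :
    hom ν a - hom ν b = 4 * (depth ν a - depth ν b) := by
  fin_cases a <;> fin_cases b <;> simp [hom, depth, pairSum] <;> ring

/-- Subtracting `pairMax ν` from every coordinate is harmless because the dual coordinates sum to
zero. -/
theorem expo_eq (ν : Fin 3 → ℤ) (x : Fin 3 → ℝ) :
    expo ν x = ∏ c, chr (depth ν c) (dualCoord x c) := by
  unfold expo chr
  rw [← Complex.exp_sum]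
  congr 1
  simp only [Fin.sum_univ_four, Fin.sum_univ_three, depth, pairSum, dualCoord]
  generalize pairMax ν = M
  simp
  ring

/-- The differences of entries of `pairSum ν` are, up to sign, exactly the forms `ν_a ± ν_b`; the
largest of them is minus the smallest depth. -/
theorem mem_dodecahedron_iff (n : ℕ) (ν : Fin 3 → ℤ) :
    ν ∈ dodecahedron n ↔ ∀ c, -(n : ℤ) ≤ depth ν c := by
  have key : (∀ c, -(n : ℤ) ≤ depth ν c) ↔ ∀ c d, pairSum ν d - pairSum ν c ≤ n := by
    obtain ⟨e, he⟩ := exists_eq_pairMax ν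
    constructor
    · intro h c d
      have := h c
      have := le_pairMax ν d
      unfold depth at *
      omega
    · intro h c
      have := h c e
      unfold depth
      omega
  rw [key]
  simp only [dodecahedron, Finset.mem_filter, Fintype.mem_piFinset, Finset.mem_Icc,
    Fin.forall_fin_succ, abs_le, pairSum]
  simp
  omega

/-- The normalized coordinates of the points of the dodecahedron. -/
def depthSet (n : ℕ) : Finset (Fin 4 → ℤ) :=
  (Fintype.piFinset fun _ => Finset.Icc (-(n : ℤ)) 0).filter fun m =>
    (∃ c, m c = 0) ∧ Even (∑ c, m c)

/-- The weight in terms of normalized coordinates. -/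
def depthWeight (n : ℕ) (m : Fin 4 → ℤ) : ℂ :=
  1 / (Nat.choose ((Finset.univ.filter fun c => m c = 0).card +
    (Finset.univ.filter fun c => m c = -(n : ℤ)).card)
    (Finset.univ.filter fun c => m c = 0).card : ℂ)

theorem depth_le (ν : Fin 3 → ℤ) (c : Fin 4) : depth ν c ≤ 0 := by
  have := le_pairMax ν c
  unfold depth
  omega

theorem exists_depth_eq (ν : Fin 3 → ℤ) : ∃ c, depth ν c = 0 := by
  obtain ⟨e, he⟩ := exists_eq_pairMax ν
  exact ⟨e, by unfold depth; omega⟩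

theorem mu_eq {n : ℕ} {ν : Fin 3 → ℤ} (hν : ∀ c, -(n : ℤ) ≤ depth ν c) :
    mu n ν = depthWeight n (depth ν) := by
  obtain ⟨e, he⟩ := exists_depth_eq ν
  have hlow : lowIdx n (hom ν) = Finset.univ.filter fun c => depth ν c = -(n : ℤ) := by
    ext b
    simp only [lowIdx, hom_sub_hom, Finset.mem_filter, Finset.mem_univ, true_and]
    constructor
    · rintro ⟨a, ha⟩
      have := hν b
      have := depth_le ν a
      omega
    · intro h
      exact ⟨e, by omega⟩
  unfold mu depthWeight
  rw [hlow]
  by_cases hJ : ∃ b, depth ν b = -(n : ℤ)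
  · obtain ⟨b, hb⟩ := hJ
    have hhigh : highIdx n (hom ν) = Finset.univ.filter fun c => depth ν c = 0 := by
      ext a
      simp only [highIdx, hom_sub_hom, Finset.mem_filter, Finset.mem_univ, true_and]
      constructor
      · rintro ⟨b, hb⟩
        have := hν b
        have := depth_le ν a
        omega
      · intro h
        exact ⟨b, by omega⟩
    rw [hhigh]
  -- No face contains the point. The zero set is nonempty while `highIdx` is empty, but both
  -- binomial coefficients are 1.
  · have hE : (Finset.univ.filter fun c => depth ν c = -(n : ℤ)) = ∅ :=
      Finset.filter_eq_empty_iff.2 fun c _ hc => hJ ⟨c, hc⟩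
    have hhigh : highIdx n (hom ν) = ∅ := by
      refine Finset.filter_eq_empty_iff.2 fun a _ => ?_
      rintro ⟨b, hb⟩
      rw [hom_sub_hom] at hb
      have := hν b
      have := depth_le ν a
      exact hJ ⟨b, by omega⟩
    rw [hE, hhigh]
    simp

/-- The inverse of `depth`. -/
def recover (m : Fin 4 → ℤ) : Fin 3 → ℤ :=
  ![(m 1 + m 2 - m 0 - m 3) / 2, (m 0 + m 2 - m 1 - m 3) / 2, (m 0 + m 1 - m 2 - m 3) / 2]

theorem sum_dodecahedron_eq (n : ℕ) (x : Fin 3 → ℝ) :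
    ∑ ν ∈ dodecahedron n, mu n ν * expo ν x =
      ∑ m ∈ depthSet n, depthWeight n m * ∏ c, chr (m c) (dualCoord x c) := by
  have hrec : ∀ m ∈ depthSet n, depth (recover m) = m := by
    intro m hm
    simp only [depthSet, Finset.mem_filter, Fintype.mem_piFinset, Finset.mem_Icc,
      Fin.sum_univ_four] at hm
    obtain ⟨h1, ⟨e, he⟩, r, hr⟩ := hm
    -- The even coordinate sum makes the halves in `recover` exact.
    have hp : ∀ c, pairSum (recover m) c = m c - m 3 := by
      intro c
      fin_cases c <;> simp [pairSum, recover] <;> omega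
    have hM : pairMax (recover m) = - m 3 := by
      apply le_antisymm
      · obtain ⟨d, hd⟩ := exists_eq_pairMax (recover m)
        rw [← hd, hp]
        have := (h1 d).2
        omega
      · have := le_pairMax (recover m) e
        rw [hp] at this
        omega
    funext c
    rw [depth, hp, hM]
    ring
  refine Finset.sum_bij' (fun ν _ => depth ν) (fun m _ => recover m) ?_ ?_ ?_ hrec ?_
  · intro ν hν
    rw [mem_dodecahedron_iff] at hν
    simp only [depthSet, Finset.mem_filter, Fintype.mem_piFinset, Finset.mem_Icc]
    refine ⟨fun c => ⟨hν c, depth_le ν c⟩, exists_depth_eq ν, ?_⟩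
    refine ⟨ν 0 + ν 1 + ν 2 - 2 * pairMax ν, ?_⟩
    simp [Fin.sum_univ_four, depth, pairSum]
    ring
  · intro m hm
    rw [mem_dodecahedron_iff, hrec m hm]
    simp only [depthSet, Finset.mem_filter, Fintype.mem_piFinset, Finset.mem_Icc] at hm
    exact fun c => (hm.1 c).1
  · intro ν hν
    funext i
    fin_cases i <;> simp [recover, depth, pairSum] <;> omega
  · intro ν hν
    rw [mem_dodecahedron_iff] at hν
    rw [mu_eq hν, expo_eq]

/-! ### Product bounds on the cells and the kernel estimate -/

/-- The points of `depthSet n` with zero set `I` and with the value `-n` exactly on `J`. -/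
def cell (n : ℕ) (I J : Finset (Fin 4)) : Finset (Fin 4 → ℤ) :=
  Fintype.piFinset fun c =>
    if c ∈ I then {0} else if c ∈ J then {-(n : ℤ)} else Finset.Ioo (-(n : ℤ)) 0

theorem filter_depthSet {n : ℕ} (hn : 1 ≤ n) {I J : Finset (Fin 4)} (hI : I.Nonempty)
    (hIJ : Disjoint I J) :
    (depthSet n).filter (fun m => (Finset.univ.filter fun c => m c = 0) = I ∧
      (Finset.univ.filter fun c => m c = -(n : ℤ)) = J) =
      (cell n I J).filter fun m => Even (∑ c, m c) := by
  ext m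
  simp only [depthSet, cell, Finset.mem_filter, Fintype.mem_piFinset]
  constructor
  · rintro ⟨⟨h1, -, h2⟩, rfl, rfl⟩
    refine ⟨fun c => ?_, h2⟩
    have := h1 c
    simp only [Finset.mem_filter, Finset.mem_univ, true_and, Finset.mem_Icc] at this ⊢
    split_ifs with h3 h4
    · simpa using h3
    · simpa using h4
    · rw [Finset.mem_Ioo]; omega
  · rintro ⟨h1, h2⟩
    have hc : ∀ c, (c ∈ I ∧ c ∉ J ∧ m c = 0) ∨ (c ∉ I ∧ c ∈ J ∧ m c = -(n : ℤ)) ∨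
        (c ∉ I ∧ c ∉ J ∧ -(n : ℤ) < m c ∧ m c < 0) := by
      intro c
      have h := h1 c
      split_ifs at h with h3 h4
      · exact Or.inl ⟨h3, Finset.disjoint_left.1 hIJ h3, by simpa using h⟩
      · exact Or.inr (Or.inl ⟨h3, h4, by simpa using h⟩)
      · exact Or.inr (Or.inr ⟨h3, h4, by simpa using h⟩)
    obtain ⟨e, he⟩ := hI
    refine ⟨⟨fun c => ?_, ⟨e, ?_⟩, h2⟩, ?_, ?_⟩
    · rw [Finset.mem_Icc]; have := hc c; omega
    · have := hc e; tauto
    · ext c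
      rw [Finset.mem_filter]
      rcases hc c with h | h | h <;> simp [h] <;> omega
    · ext c
      rw [Finset.mem_filter]
      rcases hc c with h | h | h <;> simp [h] <;> omega

/-- The product of the majorants in all directions but `a`. -/
def majorantProd (n : ℕ) (a : Fin 4) (t : Fin 4 → ℝ) : ℝ :=
  ∏ i : Fin 3, majorant n (t (a.succAbove i))

theorem majorantProd_nonneg (n : ℕ) (a : Fin 4) (t : Fin 4 → ℝ) : 0 ≤ majorantProd n a t :=
  Finset.prod_nonneg fun _ _ => majorant_nonneg _ _

/-- The sum over a box factors. Direction `a` contributes one unimodular term, so only three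
majorants remain; the other fixed coordinates are covered by `one_le_majorant`. -/
theorem norm_sum_cell_le {n : ℕ} (hn : 1 ≤ n) {I J : Finset (Fin 4)} {a : Fin 4} (ha : a ∈ I)
    (t : Fin 4 → ℝ) :
    ‖∑ m ∈ cell n I J, ∏ c, chr (m c) (t c)‖ ≤ majorantProd n a t := by
  unfold cell
  rw [← Finset.prod_univ_sum (f := fun c m => chr m (t c)), norm_prod, Fin.prod_univ_succAbove _ a, if_pos ha,
    Finset.sum_singleton, norm_chr, one_mul]
  refine Finset.prod_le_prod (fun _ _ => norm_nonneg _) fun i _ => ?_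
  split_ifs
  · rw [Finset.sum_singleton, norm_chr]; exact one_le_majorant hn _
  · rw [Finset.sum_singleton, norm_chr]; exact one_le_majorant hn _
  · exact norm_sum_chr_le hn _

theorem chr_add_half (m : ℤ) (t : ℝ) : chr m (t + 1 / 2) = (-1) ^ m * chr m t := by
  unfold chr
  rw [← Complex.exp_pi_mul_I, ← Complex.exp_int_mul, ← Complex.exp_add]
  congr 1
  push_cast
  ring

/-- The parity indicator is `(1 + (-1)^(∑ m_c)) / 2`, and the sign is produced by shifting every
`t_c` by 1/2. -/
theorem norm_sum_even_cell_le {n : ℕ} (hn : 1 ≤ n) {I J : Finset (Fin 4)} {a : Fin 4}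
    (ha : a ∈ I) (t : Fin 4 → ℝ) :
    ‖∑ m ∈ (cell n I J).filter (fun m => Even (∑ c, m c)), ∏ c, chr (m c) (t c)‖ ≤
      majorantProd n a t + majorantProd n a (fun c => t c + 1 / 2) := by
  have h : ∑ m ∈ (cell n I J).filter (fun m => Even (∑ c, m c)), ∏ c, chr (m c) (t c) =
      1 / 2 * (∑ m ∈ cell n I J, ∏ c, chr (m c) (t c) +
        ∑ m ∈ cell n I J, ∏ c, chr (m c) (t c + 1 / 2)) := by
    rw [Finset.sum_filter, ← Finset.sum_add_distrib, Finset.mul_sum]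
    refine Finset.sum_congr rfl fun m _ => ?_
    have e : ∏ c, ((-1 : ℂ)) ^ m c = (-1) ^ ∑ c, m c := by
      simp only [Fin.prod_univ_four, Fin.sum_univ_four]
      simp only [zpow_add₀ (by norm_num : (-1 : ℂ) ≠ 0)]
    simp only [chr_add_half, Finset.prod_mul_distrib, e]
    split_ifs with h
    · rw [h.neg_one_zpow]; ring
    · rw [(Int.not_even_iff_odd.1 h).neg_one_zpow]; ring
  rw [h, norm_mul]
  have h1 := norm_sum_cell_le (J := J) hn ha t
  have h2 := norm_sum_cell_le (J := J) hn ha (fun c => t c + 1 / 2)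
  have h3 := norm_add_le (∑ m ∈ cell n I J, ∏ c, chr (m c) (t c))
    (∑ m ∈ cell n I J, ∏ c, chr (m c) (t c + 1 / 2))
  have h4 := norm_nonneg (∑ m ∈ cell n I J, ∏ c, chr (m c) (t c) +
    ∑ m ∈ cell n I J, ∏ c, chr (m c) (t c + 1 / 2))
  norm_num
  linarith

theorem norm_one_div_natCast_le (k : ℕ) : ‖(1 : ℂ) / k‖ ≤ 1 := by
  rw [norm_div, norm_one, Complex.norm_natCast]
  rcases Nat.eq_zero_or_pos k with rfl | h
  · simp
  · exact div_le_one_of_le₀ (by exact_mod_cast h) (by positivity)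

theorem norm_sum_dodecahedron_le {n : ℕ} (hn : 1 ≤ n) (x : Fin 3 → ℝ) :
    ‖∑ ν ∈ dodecahedron n, mu n ν * expo ν x‖ ≤
      256 * ∑ a, (majorantProd n a (dualCoord x) +
        majorantProd n a (fun c => dualCoord x c + 1 / 2)) := by
  set t := dualCoord x
  set B := ∑ a, (majorantProd n a t + majorantProd n a (fun c => t c + 1 / 2)) with hB
  have hnn : ∀ a, 0 ≤ majorantProd n a t + majorantProd n a (fun c => t c + 1 / 2) := fun a =>
    add_nonneg (majorantProd_nonneg _ _ _) (majorantProd_nonneg _ _ _)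
  rw [sum_dodecahedron_eq, ← Finset.sum_fiberwise _ fun m : Fin 4 → ℤ =>
    ((Finset.univ.filter fun c => m c = 0), (Finset.univ.filter fun c => m c = -(n : ℤ)))]
  refine (norm_sum_le_of_le (f := _) (n := fun _ => B) _ fun IJ _ => ?_).trans ?_
  · obtain ⟨I, J⟩ := IJ
    simp only [Prod.mk.injEq]
    by_cases hIJ : I.Nonempty ∧ Disjoint I J
    · obtain ⟨⟨a, ha⟩, hd⟩ := hIJ
      have hw : ∀ m ∈ (depthSet n).filter (fun m => (Finset.univ.filter fun c => m c = 0) = I ∧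
          (Finset.univ.filter fun c => m c = -(n : ℤ)) = J),
          depthWeight n m * ∏ c, chr (m c) (t c) =
            1 / (Nat.choose (I.card + J.card) I.card : ℂ) * ∏ c, chr (m c) (t c) := by
        intro m hm
        obtain ⟨-, h1, h2⟩ := Finset.mem_filter.1 hm
        rw [depthWeight, h1, h2]
      rw [Finset.sum_congr rfl hw, ← Finset.mul_sum, norm_mul, filter_depthSet hn ⟨a, ha⟩ hd]
      refine (mul_le_of_le_one_left (norm_nonneg _) (norm_one_div_natCast_le _)).trans ?_
      refine (norm_sum_even_cell_le hn ha t).trans ?_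
      exact Finset.single_le_sum (f := fun a => majorantProd n a t +
        majorantProd n a (fun c => t c + 1 / 2)) (fun a _ => hnn a) (Finset.mem_univ a)
    · rw [Finset.sum_eq_zero, norm_zero]
      · exact Finset.sum_nonneg fun a _ => hnn a
      · intro m hm
        exfalso
        obtain ⟨h0, rfl, rfl⟩ := Finset.mem_filter.1 hm
        simp only [depthSet, Finset.mem_filter] at h0
        obtain ⟨e, he⟩ := h0.2.1
        refine hIJ ⟨⟨e, by simpa using he⟩, ?_⟩
        rw [Finset.disjoint_filter]
        intro c _ h1 h2
        omega
  -- There are `16^2 = 256` pairs of subsets of `Fin 4`.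
  · simp [Finset.card_univ]

theorem norm_Phi_le {n : ℕ} (hn : 1 ≤ n) (x : Fin 3 → ℝ) :
    ‖Phi n x‖ ≤ 128 / n ^ 3 * ∑ a, (majorantProd n a (dualCoord x) +
      majorantProd n a (fun c => dualCoord x c + 1 / 2)) := by
  have h := norm_sum_dodecahedron_le hn x
  have hn' : (0 : ℝ) < n := by exact_mod_cast hn
  unfold Phi
  rw [norm_mul]
  have e : ‖(1 : ℂ) / (2 * (n : ℂ) ^ 3)‖ = 1 / (2 * n ^ 3) := by simp
  rw [e]
  refine (mul_le_mul_of_nonneg_left h (by positivity)).trans (le_of_eq ?_)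
  generalize ∑ a, (majorantProd n a (dualCoord x) + _) = S
  field_simp
  ring

/-! ### Summation over the nodes -/

/-- Half of the homogeneous coordinates. -/
def halfHom (k : Fin 3 → ℤ) : Fin 4 → ℤ :=
  ![-k 0 + k 1 + k 2, k 0 - k 1 + k 2, k 0 + k 1 - k 2, -k 0 - k 1 - k 2]

theorem dualCoord_sub (n : ℕ) (y : Fin 3 → ℝ) (k : Fin 3 → ℤ) (c : Fin 4) :
    dualCoord (fun i => y i - (k i : ℝ) / (2 * n)) c = dualCoord y c - halfHom k c / (4 * n) := by
  fin_cases c <;> simp [dualCoord, halfHom] <;> ring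

theorem sum_majorantProd_le {n : ℕ} (hn : 2 ≤ n) (a : Fin 4) (τ : Fin 4 → ℝ) :
    ∑ k ∈ Xi n, majorantProd n a (fun c => τ c - halfHom k c / (4 * n)) ≤
      (224 * n * Real.log n) ^ 3 := by
  -- The four coordinates sum to zero, so omitting the one at `a` loses nothing.
  have hinj : ∀ k l : Fin 3 → ℤ, (fun i : Fin 3 => halfHom k (a.succAbove i)) =
      (fun i => halfHom l (a.succAbove i)) → k = l := by
    intro k l h
    have h0 := congrFun h 0
    have h1 := congrFun h 1
    have h2 := congrFun h 2
    funext i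
    fin_cases a <;> simp [halfHom, Fin.succAbove] at h0 h1 h2 <;> fin_cases i <;> simp <;> omega
  calc ∑ k ∈ Xi n, majorantProd n a (fun c => τ c - halfHom k c / (4 * n))
      = ∑ s ∈ (Xi n).image (fun k => fun i : Fin 3 => halfHom k (a.succAbove i)),
          ∏ i, majorant n (τ (a.succAbove i) - s i / (4 * n)) := by
        rw [Finset.sum_image fun k _ l _ h => hinj k l h]
        rfl
    -- By nonnegativity the image may be enlarged to a full box, over which the sum factors.
    _ ≤ ∑ s ∈ Fintype.piFinset (fun _ : Fin 3 => Finset.Icc (-(3 * n : ℤ)) (3 * n)),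
          ∏ i, majorant n (τ (a.succAbove i) - s i / (4 * n)) := by
        refine Finset.sum_le_sum_of_subset_of_nonneg ?_
          fun _ _ _ => Finset.prod_nonneg fun _ _ => majorant_nonneg _ _
        intro s hs
        obtain ⟨k, hk, rfl⟩ := Finset.mem_image.1 hs
        have hk' := (Finset.mem_filter.1 hk).1
        simp only [Fintype.mem_piFinset, Finset.mem_Icc] at hk' ⊢
        intro i
        have h0 := hk' 0
        have h1 := hk' 1
        have h2 := hk' 2
        generalize a.succAbove i = c
        fin_cases c <;> simp [halfHom] <;> omega
    _ = ∏ i : Fin 3, ∑ s ∈ Finset.Icc (-(3 * n : ℤ)) (3 * n),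
          majorant n (τ (a.succAbove i) - s / (4 * n)) := by rw [Finset.prod_univ_sum]
    _ ≤ ∏ _i : Fin 3, 224 * n * Real.log n :=
        Finset.prod_le_prod
          (fun _ _ => Finset.sum_nonneg fun _ _ => majorant_nonneg _ _)
          fun i _ => sum_majorant_le hn _
    _ = _ := by simp

theorem sum_norm_Phi_le {n : ℕ} (hn : 2 ≤ n) (y : Fin 3 → ℝ) :
    ∑ k ∈ Xi n, ‖Phi n fun i => y i - (k i : ℝ) / (2 * n)‖ ≤
      1024 * 224 ^ 3 * Real.log n ^ 3 := by
  have hn' : (0 : ℝ) < n := by positivity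
  calc ∑ k ∈ Xi n, ‖Phi n fun i => y i - (k i : ℝ) / (2 * n)‖
      ≤ ∑ k ∈ Xi n, 128 / (n : ℝ) ^ 3 *
          ∑ a, (majorantProd n a (fun c => dualCoord y c - halfHom k c / (4 * n)) +
            majorantProd n a (fun c => (dualCoord y c + 1 / 2) - halfHom k c / (4 * n))) := by
        refine Finset.sum_le_sum fun k _ => (norm_Phi_le (by omega) _).trans (le_of_eq ?_)
        have h1 : dualCoord (fun i => y i - (k i : ℝ) / (2 * n)) =
          fun c => dualCoord y c - halfHom k c / (4 * n) := funext (dualCoord_sub n y k)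
        simp only [h1, sub_add_eq_add_sub]
    _ = 128 / (n : ℝ) ^ 3 *
          ∑ a, (∑ k ∈ Xi n, majorantProd n a (fun c => dualCoord y c - halfHom k c / (4 * n)) +
            ∑ k ∈ Xi n, majorantProd n a
              (fun c => (dualCoord y c + 1 / 2) - halfHom k c / (4 * n))) := by
        rw [← Finset.mul_sum, Finset.sum_comm]
        simp only [Finset.sum_add_distrib]
    _ ≤ 128 / (n : ℝ) ^ 3 * ∑ _a : Fin 4, ((224 * n * Real.log n) ^ 3 +
          (224 * n * Real.log n) ^ 3) := by
        gcongr with a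
        · exact sum_majorantProd_le hn a _
        · exact sum_majorantProd_le hn a (fun c => dualCoord y c + 1 / 2)
    _ = 1024 * 224 ^ 3 * Real.log n ^ 3 := by
        rw [Finset.sum_const, Finset.card_univ, Fintype.card_fin]
        field_simp
        ring

theorem norm_lam_le (n : ℕ) (k : Fin 3 → ℤ) : ‖lam n k‖ ≤ 8 := by
  unfold lam
  rw [norm_pow, Complex.norm_ofNat, show (8 : ℝ) = 2 ^ 3 by norm_num]
  exact pow_le_pow_right₀ (by norm_num) (Finset.card_le_univ _)

theorem sum_norm_ell_le {n : ℕ} (hn : 2 ≤ n) (x : Fin 3 → ℝ) :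
    ∑ k ∈ Xi n, ‖ell n k x‖ ≤ 8 * (1024 * 224 ^ 3 * Real.log n ^ 3) := by
  calc ∑ k ∈ Xi n, ‖ell n k x‖
      ≤ ∑ k ∈ Xi n, ∑ ε : Fin 3 → ℤˣ,
          ‖Phi n fun i => ((ε i : ℤ) : ℝ) * x i - (k i : ℝ) / (2 * n)‖ := by
        refine Finset.sum_le_sum fun k _ => ?_
        unfold ell evenPart
        rw [norm_mul, norm_mul]
        have h1 : ‖(1 / 8 : ℂ)‖ = 1 / 8 := by simp
        rw [h1]
        have h2 := norm_lam_le n k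
        set S := ∑ ε : Fin 3 → ℤˣ, Phi n fun i => ((ε i : ℤ) : ℝ) * x i - (k i : ℝ) / (2 * n)
        have h3 : ‖S‖ ≤ _ := norm_sum_le _ _
        nlinarith [norm_nonneg S]
    _ = ∑ ε : Fin 3 → ℤˣ, ∑ k ∈ Xi n,
          ‖Phi n fun i => ((ε i : ℤ) : ℝ) * x i - (k i : ℝ) / (2 * n)‖ := Finset.sum_comm
    _ ≤ ∑ _ε : Fin 3 → ℤˣ, 1024 * 224 ^ 3 * Real.log n ^ 3 :=
        Finset.sum_le_sum fun ε _ => sum_norm_Phi_le hn _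
    _ = _ := by
        rw [Finset.sum_const, Finset.card_univ, Fintype.card_fun, Fintype.card_units_int,
          Fintype.card_fin]
        norm_num

end CubeInterp

end

theorem mainTheorem6 :
    ∃ c : ℝ, ∀ n : ℕ, 2 ≤ n → ‖CubeInterp.L n‖ ≤ c * Real.log n ^ 3 := by
  refine ⟨8 * (1024 * 224 ^ 3), fun n hn => ?_⟩
  have hlog : 0 ≤ Real.log n := Real.log_natCast_nonneg n
  refine ContinuousLinearMap.opNorm_le_bound _ (by positivity) fun f => ?_
  refine (ContinuousMap.norm_le _ (by positivity)).2 fun s => ?_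
  rw [CubeInterp.L_apply]
  refine (norm_sum_le _ _).trans ?_
  calc ∑ k ∈ CubeInterp.Xi n, ‖f (CubeInterp.node n k) * CubeInterp.ellStar n k s‖
      ≤ ∑ k ∈ CubeInterp.Xi n, ‖f‖ * ‖CubeInterp.ellStar n k s‖ := by
        refine Finset.sum_le_sum fun k _ => ?_
        rw [norm_mul]
        gcongr
        exact f.norm_coe_le_norm _
    _ = (∑ k ∈ CubeInterp.Xi n, ‖CubeInterp.ellStar n k s‖) * ‖f‖ := by
        rw [← Finset.mul_sum, mul_comm]
    _ ≤ 8 * (1024 * 224 ^ 3) * Real.log n ^ 3 * ‖f‖ := by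
        gcongr
        exact (CubeInterp.sum_norm_ell_le hn _).trans (le_of_eq (by ring))
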